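/- Consider $K$ actions $\mathcal K=\{1,\dots,K\}$ and a random probability distribution $p^*$ on $[0,1]^K$ (drawn from an arbitrary prior). Conditionally on $p^*$, the reward vectors $Y_t=(Y_{t,a})_{a\in\mathcal K}$, $t\ge 1$, are independent and identically distributed with law $p^*$; the coordinates of a reward vector may be dependent. Let $A^*$ be a random action that almost surely maximizes the true mean reward $a\mapsto\int y_a\,dp^*(y)$, and let $G_t=(\mathcal K,\mathcal E_t)$, $t\ge1$, be an arbitrary deterministic sequence of directed graphs. In round $t$ the decision maker plays an action $A_t$ and then observes $Y_{t,A_t}$ and $Y_{t,a}$ for every $a$ with $(A_t,a)\in\mathcal E_t$. Let $\mathcal F_t$ be the $\sigma$-algebra generated by the actions and observations of rounds $1,\dots,t-1$, and let $\alpha_t(a)=\mathbb P(A^*=a\mid\mathcal F_t)$ be the posterior distribution of $A^*$; in particular $\alpha_1$ is its prior distribution. The policy TS-N (Thompson sampling) draws $A_t$ from $\alpha_t$, with randomness that, given $\mathcal F_t$, is independent of $p^*$, $A^*$ and all the rewards $(Y_s)_{s\ge1}$. Then for every horizon $T$ the Bayesian regret of TS-N satisfies $$\mathbb E\Big[\sum_{t=1}^T\big(Y_{t,A^*}-Y_{t,A_t}\big)\Big]\;\le\;\sqrt{\frac12\sum_{t=1}^T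 \mathrm{mas}(G_t)\,H(\alpha_1)} .$$ Here $H(\alpha)=-\sum_{a}\alpha(a)\log\alpha(a)$ is the Shannon entropy (natural logarithm, $0\log 0=0$), and $\mathrm{mas}(G)$, the maximum acyclic subgraph number of $G$, is the largest cardinality of a set $\mathcal K'\subseteq\mathcal K$ such that the subgraph of $G$ induced by $\mathcal K'$ contains no directed cycle through two or more distinct vertices (self-loops are not counted as cycles). -/

import Mathlib

open MeasureTheory ProbabilityTheory unitInterval

namespace GraphBandit

/-- `S` induces an acyclic subgraph of `G`: no directed cycle `v 0 → v 1 → ⋯ → v (n+1) → v 0`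
through `n + 2 ≥ 2` distinct vertices has all its vertices in `S` (the index `i + 1` is taken
modulo `n + 2`). Self-loops are not counted as cycles; two opposite arcs are one. -/
def IsAcyclicOn {V : Type*} (G : Digraph V) (S : Finset V) : Prop :=
  ¬ ∃ (n : ℕ) (v : Fin (n + 2) → V),
    Function.Injective v ∧ (∀ i, v i ∈ S) ∧ ∀ i, G.Adj (v i) (v (i + 1))

open Classical in
/-- The maximum acyclic subgraph number: the largest size of a vertex set that induces an
acyclic subgraph. -/
noncomputable def mas {V : Type*} [Fintype V] (G : Digraph V) : ℕ :=
  (Finset.univ.filter fun S : Finset V => IsAcyclicOn G S).sup Finset.card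

/-- Shannon entropy (natural logarithm, with `0 log 0 = 0`) of a distribution on a finite set. -/
noncomputable def shannonEntropy {V : Type*} [Fintype V] (p : V → ℝ) : ℝ :=
  - ∑ i, p i * Real.log (p i)

/-- The mean reward of action `a` under the distribution `p` of the reward vector. -/
noncomputable def meanReward {K : ℕ} (p : Measure (Fin K → I)) (a : Fin K) : ℝ :=
  ∫ y, (y a : ℝ) ∂p

/-- A Bayesian stochastic bandit with `K` actions and rewards in `[0, 1]`, defined on the
probability space `(Ω, μ)`. Rounds are indexed from `0`. -/
structure BayesianBandit (K : ℕ) {Ω : Type*} [mΩ : MeasurableSpace Ω] (μ : Measure Ω) where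
  /-- the random true distribution of the reward vector; its law is the prior -/
  pStar : Ω → Measure (Fin K → I)
  measurable_pStar : Measurable pStar
  isProbabilityMeasure_pStar : ∀ ω, IsProbabilityMeasure (pStar ω)
  /-- the reward vectors: `Y t ω a` is the reward of action `a` in round `t` -/
  Y : ℕ → Ω → Fin K → I
  measurable_Y : ∀ t, Measurable (Y t)
  /-- conditionally on `pStar`, the reward vectors are independent with distribution `pStar` -/
  condLaw_Y : ∀ (s : Finset ℕ) (B : ℕ → Set (Fin K → I)), (∀ t, MeasurableSet (B t)) →
    μ⟦⋂ t ∈ s, Y t ⁻¹' B t | MeasurableSpace.comap pStar inferInstance⟧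
      =ᵐ[μ] fun ω => ∏ t ∈ s, (pStar ω).real (B t)
  /-- the optimal action: almost surely a maximiser of the true mean reward -/
  AStar : Ω → Fin K
  measurable_AStar : Measurable AStar
  optimal_AStar : ∀ᵐ ω ∂μ, ∀ a, meanReward (pStar ω) a ≤ meanReward (pStar ω) (AStar ω)

namespace BayesianBandit

variable {K : ℕ} {Ω : Type*} [mΩ : MeasurableSpace Ω] {μ : Measure Ω}

/-- The σ-algebra of everything that the decision maker does not influence: the true
distribution, the optimal action, and the rewards of all actions in all rounds. -/
@[reducible] def environment (M : BayesianBandit K μ) : MeasurableSpace Ω :=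
  MeasurableSpace.comap M.pStar inferInstance ⊔ MeasurableSpace.comap M.AStar inferInstance ⊔
    ⨆ t, MeasurableSpace.comap (M.Y t) inferInstance

open Classical in
/-- What the decision maker learns in round `t`: the action played, its reward, and the rewards
of its out-neighbours in `G t`. The coordinates that are not observed are replaced by `0`
(which ones these are is determined by the action played, as `G t` is deterministic). -/
noncomputable def observation (M : BayesianBandit K μ) (G : ℕ → Digraph (Fin K))
    (A : ℕ → Ω → Fin K) (t : ℕ) (ω : Ω) : Fin K × (Fin K → I) :=
  (A t ω, fun a => if a = A t ω ∨ (G t).Adj (A t ω) a then M.Y t ω a else 0)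

/-- The σ-algebra generated by the observations of the rounds before round `t`. -/
@[reducible] noncomputable def history (M : BayesianBandit K μ) (G : ℕ → Digraph (Fin K)) (A : ℕ → Ω → Fin K) (t : ℕ) :
    MeasurableSpace Ω :=
  ⨆ s ∈ Finset.range t, MeasurableSpace.comap (M.observation G A s) inferInstance

/-- The prior distribution of the optimal action. -/
noncomputable def prior (M : BayesianBandit K μ) (a : Fin K) : ℝ :=
  μ.real (M.AStar ⁻¹' {a})

/-- The posterior distribution of the optimal action given the history before round `t`. -/
noncomputable def posterior (M : BayesianBandit K μ) (G : ℕ → Digraph (Fin K))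
    (A : ℕ → Ω → Fin K) (t : ℕ) (a : Fin K) : Ω → ℝ :=
  μ⟦M.AStar ⁻¹' {a} | M.history G A t⟧

/-- The actions `A` are chosen by the randomized policy with sampling distributions `π`:
in every round `t`, `π t` is a function of the history, and the action is drawn from `π t` by
means of randomness that is independent of the environment given the history. -/
structure FollowsPolicy (M : BayesianBandit K μ) (G : ℕ → Digraph (Fin K))
    (A : ℕ → Ω → Fin K) (π : ℕ → Fin K → Ω → ℝ) : Prop where
  measurable_action : ∀ t, Measurable (A t)
  adapted : ∀ t a, Measurable[M.history G A t] (π t a)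
  sampling : ∀ t a, μ⟦A t ⁻¹' {a} | M.history G A t ⊔ M.environment⟧ =ᵐ[μ] π t a

/-- TS-N (Thompson sampling): the sampling distribution is the posterior distribution of the
optimal action. -/
def IsTSN (M : BayesianBandit K μ) (G : ℕ → Digraph (Fin K)) (A : ℕ → Ω → Fin K) : Prop :=
  M.FollowsPolicy G A (M.posterior G A)

/-- The Bayesian regret over the first `T` rounds of playing the actions `A`. -/
noncomputable def bayesRegret (M : BayesianBandit K μ) (A : ℕ → Ω → Fin K) (T : ℕ) : ℝ :=
  ∫ ω, ∑ t ∈ Finset.range T, ((M.Y t ω (M.AStar ω) : ℝ) - (M.Y t ω (A t ω) : ℝ)) ∂μ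

end BayesianBandit

end GraphBandit

namespace GraphBandit

/-! Given the history, Thompson sampling gives `A t` the law of `A*` but makes it independent of the
environment. The regret of a round is therefore a sum over `a` of covariances E[1{A* = a}(y - e)],
with y the reward of `a` and e its mean given the history (`bayesRegret_eq`). Each covariance is
paid for by information. Fenchel's inequality for p log p, taken at log α + x with α the current
posterior weight of `a`, bounds E[1{A* = a} x] by the expected growth of p log p over the round, for
every bounded x known after the round with E[exp x | history] ≤ 1
(`integral_mul_le_integral_mul_log_sub`). Let o indicate that y is observed and let q be its
conditional probability. The choice x = o(l(y - e) - l²/8) with l = c/q, up to a cutoff, is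
admissible by Hoeffding's lemma (`integral_mul_exp_le`). As o is conditionally independent of the
environment, E[1{A* = a} x] is c times the covariance minus (c²/8) E[α/q]. Over the actions, the
ratios α/q sum to at most the maximum acyclic subgraph number (`sum_div_le_mas`). Over the rounds,
the gains telescope from minus the prior entropy to at most 0. This bounds c times the regret for
every c > 0, and optimising c gives the square root. -/

/-! ### Acyclic sets and weights of closed in-neighbourhoods -/

lemma IsAcyclicOn.empty {V : Type*} (G : Digraph V) : IsAcyclicOn G ∅ := by
  rintro ⟨n, v, -, hS, -⟩
  simpa using hS 0

/-- Adding a vertex without incoming arcs from `S` keeps `S` acyclic. -/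
lemma IsAcyclicOn.insert {V : Type*} [DecidableEq V] {G : Digraph V} {S : Finset V}
    (hS : IsAcyclicOn G S) {i : V} (hi : ∀ k ∈ S, ¬ G.Adj k i) :
    IsAcyclicOn G (insert i S) := by
  rintro ⟨n, v, hv, hmem, hadj⟩
  by_cases h : ∃ j, v j = i
  · obtain ⟨j, rfl⟩ := h
    -- The cyclic predecessor of the new vertex differs from it, as the cycle has at least two
    -- vertices, so it lies in `S`.
    have h1 := hadj (j - 1)
    rw [sub_add_cancel] at h1
    have hne : v (j - 1) ≠ v j := by
      intro h2
      have h3 := hv h2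
      rw [sub_eq_self] at h3
      exact one_ne_zero h3
    exact hi _ (Finset.mem_of_mem_insert_of_ne (hmem _) hne) h1
  · push Not at h
    exact hS ⟨n, v, hv, fun j => Finset.mem_of_mem_insert_of_ne (hmem j) (h j), hadj⟩

open Classical in
lemma IsAcyclicOn.card_le_mas {V : Type*} [Fintype V] {G : Digraph V} {S : Finset V}
    (hS : IsAcyclicOn G S) : S.card ≤ mas G :=
  Finset.le_sup (f := Finset.card) (by simpa using hS)

open Classical in
-- Greedy choice: take the vertex `i` whose closed in-neighbourhood is lightest and delete that
-- neighbourhood. The deleted terms sum to at most 1, and no surviving vertex has an arc into `i`,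
-- so `i` can join the acyclic set found among the survivors.
lemma exists_isAcyclicOn_sum_div_le {V : Type*} (G : Digraph V) (p : V → ℝ)
    (hp : ∀ a, 0 ≤ p a) (U : Finset V) :
    ∃ S ⊆ U, IsAcyclicOn G S ∧
      ∑ a ∈ U, p a / ∑ k ∈ U with (k = a ∨ G.Adj k a), p k ≤ S.card := by
  induction U using Finset.strongInduction with
  | H U ih =>
  rcases U.eq_empty_or_nonempty with rfl | hU
  · exact ⟨∅, le_rfl, IsAcyclicOn.empty G, by simp⟩
  set Q : V → ℝ := fun a => ∑ k ∈ U with (k = a ∨ G.Adj k a), p k with hQ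
  have hQ0 : ∀ a, 0 ≤ Q a := fun a => Finset.sum_nonneg fun k _ => hp k
  have hpQ : ∀ a ∈ U, p a ≤ Q a := fun a ha =>
    Finset.single_le_sum (f := p) (fun k _ => hp k) (by simp [ha])
  obtain ⟨i, hiU, hi⟩ := U.exists_min_image Q hU
  obtain ⟨S, hSU, hS, hle⟩ := ih (U.filter fun k => ¬ (k = i ∨ G.Adj k i))
    (Finset.filter_ssubset.2 ⟨i, hiU, by simp⟩)
  have hiS : ∀ k ∈ S, ¬ (k = i ∨ G.Adj k i) := fun k hk => (Finset.mem_filter.1 (hSU hk)).2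
  refine ⟨insert i S, ?_, hS.insert fun k hk h => hiS k hk (Or.inr h), ?_⟩
  · exact Finset.insert_subset hiU (hSU.trans (Finset.filter_subset _ _))
  rw [Finset.card_insert_of_notMem fun h => hiS i h (Or.inl rfl),
    ← Finset.sum_filter_add_sum_filter_not U (fun k => k = i ∨ G.Adj k i)]
  have h1 : ∑ a ∈ U with (a = i ∨ G.Adj a i), p a / Q a ≤ 1 := by
    calc ∑ a ∈ U with (a = i ∨ G.Adj a i), p a / Q a
        ≤ ∑ a ∈ U with (a = i ∨ G.Adj a i), p a / Q i := by
          refine Finset.sum_le_sum fun a ha => ?_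
          have haU := (Finset.mem_filter.1 ha).1
          rcases (hQ0 i).eq_or_lt with h | h
          · have : p a = 0 := le_antisymm
              ((Finset.single_le_sum (f := p) (fun k _ => hp k) ha).trans h.ge) (hp a)
            simp [this]
          · exact div_le_div_of_nonneg_left (hp a) h (hi a haU)
      _ = Q i / Q i := by rw [← Finset.sum_div]
      _ ≤ 1 := div_self_le_one _
  have h2 : ∑ a ∈ U with ¬ (a = i ∨ G.Adj a i), p a / Q a ≤ S.card := by
    refine le_trans (Finset.sum_le_sum fun a ha => ?_) hle
    have hsub : ∑ k ∈ (U.filter fun k => ¬ (k = i ∨ G.Adj k i)) with (k = a ∨ G.Adj k a), p k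
        ≤ Q a := Finset.sum_le_sum_of_subset_of_nonneg
          (Finset.filter_subset_filter _ (Finset.filter_subset _ _)) fun k _ _ => hp k
    have hpa := Finset.single_le_sum (f := p)
      (s := (U.filter fun k => ¬ (k = i ∨ G.Adj k i)).filter fun k => k = a ∨ G.Adj k a)
      (fun k _ => hp k) (a := a) (by simpa using ha)
    -- A positive `p a` keeps the smaller denominator positive; with zero denominators, where the
    -- quotient is 0, monotonicity could fail.
    rcases (hp a).eq_or_lt with h | h
    · simp [← h]
    · exact div_le_div_of_nonneg_left (hp a) (h.trans_le hpa) hsub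
  push_cast
  linarith

open Classical in
/-- For nonnegative weights, `∑ a, p a / p (N⁻[a])` is at most the maximum acyclic subgraph
number, where `N⁻[a]` is the closed in-neighbourhood of `a`. -/
lemma sum_div_le_mas {V : Type*} [Fintype V] (G : Digraph V) (p : V → ℝ) (hp : ∀ a, 0 ≤ p a) :
    ∑ a, p a / ∑ k with (k = a ∨ G.Adj k a), p k ≤ mas G := by
  obtain ⟨S, -, hS, hle⟩ := exists_isAcyclicOn_sum_div_le G p hp Finset.univ
  exact hle.trans (by exact_mod_cast hS.card_le_mas)

/-! ### Scalar inequalities -/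

/-- Hoeffding's lemma for a Bernoulli distribution. -/
lemma bernoulli_hoeffding (l m : ℝ) (h0 : 0 ≤ m) (h1 : m ≤ 1) :
    (1 - m) * Real.exp (-l * m) + m * Real.exp (l * (1 - m)) ≤ Real.exp (l ^ 2 / 8) := by
  set ν : Measure ℝ := ENNReal.ofReal (1 - m) • Measure.dirac 0 + ENNReal.ofReal m • Measure.dirac 1
    with hν
  have hint : ∀ f : ℝ → ℝ, ∫ x, f x ∂ν = (1 - m) * f 0 + m * f 1 := by
    intro f
    rw [hν, integral_add_measure, integral_smul_measure, integral_smul_measure]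
    · simp [ENNReal.toReal_ofReal, h0, h1]
    · exact (integrable_dirac (by simp)).smul_measure (by simp)
    · exact (integrable_dirac (by simp)).smul_measure (by simp)
  have : IsProbabilityMeasure ν := ⟨by
    simp [hν, ← ENNReal.ofReal_add (sub_nonneg.2 h1) h0]⟩
  have hI : ∀ᵐ x ∂ν, id x ∈ Set.Icc (0 : ℝ) 1 := by
    rw [hν, ae_add_measure_iff]
    constructor <;>
    · refine Measure.ae_smul_measure ?_ _
      rw [ae_dirac_eq]
      simp
  -- An interval of length 1 gives variance proxy 1/4, hence the exponent l²/8.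
  have h := (hasSubgaussianMGF_of_mem_Icc (μ := ν) (X := id) aemeasurable_id hI).mgf_le l
  rw [mgf, hint, hint] at h
  refine le_trans (le_of_eq ?_) (h.trans (le_of_eq ?_))
  · simp
  · congr 1; simp; ring

/-- The exponential `exp (l * (y - m) - l ^ 2 / 8)` lies below its chord on `[0, 1]`. -/
lemma exp_le_chord (l m y : ℝ) (h0 : 0 ≤ y) (h1 : y ≤ 1) :
    Real.exp (l * (y - m) - l ^ 2 / 8) ≤
      (1 - y) * Real.exp (-l * m - l ^ 2 / 8) + y * Real.exp (l * (1 - m) - l ^ 2 / 8) := by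
  have h := convexOn_exp.2 (Set.mem_univ (-l * m - l ^ 2 / 8))
    (Set.mem_univ (l * (1 - m) - l ^ 2 / 8)) (sub_nonneg.2 h1) h0 (by ring)
  simp only [smul_eq_mul] at h
  refine le_trans (le_of_eq ?_) h
  congr 1; ring

/-- The chord is affine in y, so its conditional mean is its value at the conditional mean of y;
Hoeffding's lemma is needed only for a Bernoulli law. -/
lemma chord_mean_le (l m : ℝ) (h0 : 0 ≤ m) (h1 : m ≤ 1) :
    (1 - m) * Real.exp (-l * m - l ^ 2 / 8) + m * Real.exp (l * (1 - m) - l ^ 2 / 8) ≤ 1 := by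
  rw [Real.exp_sub, Real.exp_sub, ← mul_div_assoc, ← mul_div_assoc, ← add_div,
    div_le_one (Real.exp_pos _)]
  exact bernoulli_hoeffding l m h0 h1

/-- Fenchel's inequality for `p ↦ p * log p`. -/
lemma fenchel_mul_log (p w : ℝ) (hp : 0 ≤ p) : p + p * w - Real.exp w ≤ p * Real.log p := by
  rcases hp.eq_or_lt with rfl | hp
  · simp [(Real.exp_pos w).le]
  · have h := Real.add_one_le_exp (w - Real.log p)
    rw [Real.exp_sub, Real.exp_log hp, le_div_iff₀ hp] at h
    linarith

/-- The quadratic (S/8)c² - Rc + H is nonnegative for c > 0 by hypothesis, and for c ≤ 0 because R >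
0 in the nontrivial case. Its discriminant is thus nonpositive, which is R² ≤ SH/2. -/
lemma le_sqrt_of_forall_mul_le {R H S : ℝ} (hH : 0 ≤ H) (hS : 0 ≤ S)
    (h : ∀ c > 0, c * R ≤ H + c ^ 2 / 8 * S) : R ≤ √(1 / 2 * (S * H)) := by
  rcases le_or_gt R 0 with hR | hR
  · exact hR.trans (Real.sqrt_nonneg _)
  refine Real.le_sqrt_of_sq_le ?_
  have hd := discrim_le_zero (a := S / 8) (b := -R) (c := H) fun c => by
    rcases le_or_gt c 0 with hc | hc
    · have : 0 ≤ S / 8 * (c * c) :=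
        mul_nonneg (div_nonneg hS (by norm_num)) (mul_self_nonneg c)
      nlinarith
    · linarith [h c hc]
  rw [discrim] at hd
  linarith

/-! ### Conditional expectations of bounded functions -/

section Conditioning

variable {Ω : Type*} {m m' n mΩ : MeasurableSpace Ω} {μ : Measure Ω}

lemma memLp_top_mul {f g : Ω → ℝ} (hf : MemLp f ⊤ μ) (hg : MemLp g ⊤ μ) :
    MemLp (fun ω => f ω * g ω) ⊤ μ := MemLp.mul hg hf

lemma memLp_top_add {f g : Ω → ℝ} (hf : MemLp f ⊤ μ) (hg : MemLp g ⊤ μ) :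
    MemLp (fun ω => f ω + g ω) ⊤ μ := hf.add hg

lemma memLp_top_sub {f g : Ω → ℝ} (hf : MemLp f ⊤ μ) (hg : MemLp g ⊤ μ) :
    MemLp (fun ω => f ω - g ω) ⊤ μ := hf.sub hg

lemma exists_ae_abs_le {f : Ω → ℝ} (hf : MemLp f ⊤ μ) : ∃ C, ∀ᵐ ω ∂μ, |f ω| ≤ C :=
  ⟨_, ae_le_lpNorm_exponent_top hf⟩

lemma memLp_top_exp {f : Ω → ℝ} (hf : MemLp f ⊤ μ) :
    MemLp (fun ω => Real.exp (f ω)) ⊤ μ := by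
  obtain ⟨C, hC⟩ := exists_ae_abs_le hf
  refine memLp_top_of_bound (Real.continuous_exp.comp_aestronglyMeasurable hf.1) (Real.exp C) ?_
  filter_upwards [hC] with ω h
  rw [Real.norm_eq_abs, Real.abs_exp]
  exact Real.exp_le_exp.2 ((le_abs_self _).trans h)

lemma memLp_top_of_ae_mem_Icc {f : Ω → ℝ} {a b : ℝ} (hf : AEStronglyMeasurable f μ)
    (h : ∀ᵐ ω ∂μ, f ω ∈ Set.Icc a b) : MemLp f ⊤ μ := by
  refine memLp_top_of_bound hf (max |a| |b|) ?_
  filter_upwards [h] with ω h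
  exact abs_le_max_abs_abs h.1 h.2

lemma memLp_top_mul_log {f : Ω → ℝ} (hf : AEStronglyMeasurable f μ)
    (h : ∀ᵐ ω ∂μ, f ω ∈ Set.Icc 0 1) : MemLp (fun ω => f ω * Real.log (f ω)) ⊤ μ := by
  obtain ⟨C, hC⟩ := isCompact_Icc.exists_bound_of_continuousOn
    (Real.continuous_mul_log.continuousOn (s := Set.Icc 0 1))
  exact memLp_top_of_bound (Real.continuous_mul_log.comp_aestronglyMeasurable hf) C
    (h.mono fun ω hω => hC _ hω)

variable [IsProbabilityMeasure μ]

lemma condExp_ae_mem_Icc (hm : m ≤ mΩ) {f : Ω → ℝ} (hf : MemLp f ⊤ μ)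
    (h : ∀ᵐ ω ∂μ, f ω ∈ Set.Icc 0 1) : ∀ᵐ ω ∂μ, (μ[f|m]) ω ∈ Set.Icc (0 : ℝ) 1 := by
  have h1 := condExp_mono (m := m) (hf.integrable le_top) (integrable_const (1 : ℝ))
    (h.mono fun ω hω => hω.2)
  rw [condExp_const hm] at h1
  filter_upwards [condExp_nonneg (m := m) (h.mono fun ω hω => hω.1), h1] with ω h0 h1
  exact ⟨h0, h1⟩

/-- Conditioning one factor of an expectation. -/
lemma integral_mul_eq_integral_condExp_mul (hm : m ≤ mΩ) {f g : Ω → ℝ} (hf : MemLp f ⊤ μ)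
    (hg : MemLp g ⊤ μ) (hgm : StronglyMeasurable[m] g) :
    ∫ ω, f ω * g ω ∂μ = ∫ ω, (μ[f|m]) ω * g ω ∂μ := by
  have h := condExp_mul_of_stronglyMeasurable_right hgm
    ((memLp_top_mul hf hg).integrable le_top) (hf.integrable le_top)
  exact (integral_condExp hm).symm.trans (integral_congr_ae h)

/-- A conditional form of Hoeffding's lemma for a quantity `y` that is revealed with
conditional probability `q`. -/
lemma integral_mul_exp_le (hm : m ≤ mΩ) (hn : n ≤ mΩ) (hmn : m ≤ n)
    {w l q o y : Ω → ℝ} (hw : MemLp w ⊤ μ) (hwm : StronglyMeasurable[m] w)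
    (hw0 : ∀ᵐ ω ∂μ, 0 ≤ w ω)
    (hl : MemLp l ⊤ μ) (hlm : StronglyMeasurable[m] l)
    (hq : MemLp q ⊤ μ) (hqm : StronglyMeasurable[m] q) (hq0 : ∀ᵐ ω ∂μ, 0 ≤ q ω)
    (ho : MemLp o ⊤ μ) (ho1 : ∀ ω, o ω ∈ Set.Icc 0 1) (hoq : μ[o|n] =ᵐ[μ] q)
    (hy : MemLp y ⊤ μ) (hyn : StronglyMeasurable[n] y) (hy1 : ∀ ω, y ω ∈ Set.Icc 0 1) :
    ∫ ω, w ω * Real.exp (o ω * (l ω * (y ω - (μ[y|m]) ω) - l ω ^ 2 / 8)) ∂μ ≤ ∫ ω, w ω ∂μ := by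
  set e : Ω → ℝ := μ[y|m] with he
  have hem : StronglyMeasurable[m] e := stronglyMeasurable_condExp
  have he1 : ∀ᵐ ω ∂μ, e ω ∈ Set.Icc 0 1 := condExp_ae_mem_Icc hm hy (.of_forall hy1)
  have heL : MemLp e ⊤ μ := memLp_top_of_ae_mem_Icc (hem.mono hm).aestronglyMeasurable he1
  have hl2 : MemLp (fun ω => l ω ^ 2 / 8) ⊤ μ := by
    simpa only [sq, mul_div_assoc, div_eq_inv_mul] using (memLp_top_mul hl hl).const_mul (8 : ℝ)⁻¹
  set u : Ω → ℝ := fun ω => Real.exp (-l ω * e ω - l ω ^ 2 / 8) with hu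
  set v : Ω → ℝ := fun ω => Real.exp (l ω * (1 - e ω) - l ω ^ 2 / 8) with hv
  have hum : StronglyMeasurable[m] u :=
    Real.continuous_exp.comp_stronglyMeasurable ((hlm.neg.mul hem).sub ((hlm.measurable.pow_const 2).div_const 8 |>.stronglyMeasurable))
  have hvm : StronglyMeasurable[m] v :=
    Real.continuous_exp.comp_stronglyMeasurable
      ((hlm.mul (stronglyMeasurable_const.sub hem)).sub ((hlm.measurable.pow_const 2).div_const 8 |>.stronglyMeasurable))
  have huL : MemLp u ⊤ μ := memLp_top_exp (memLp_top_sub (memLp_top_mul hl.neg heL) hl2)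
  have hvL : MemLp v ⊤ μ :=
    memLp_top_exp (memLp_top_sub (memLp_top_mul hl (memLp_top_sub (memLp_const 1) heL)) hl2)
  have hvu := memLp_top_sub hvL huL
  have hu1 := memLp_top_sub huL (memLp_const 1)
  have hexpL : MemLp (fun ω => Real.exp (o ω * (l ω * (y ω - e ω) - l ω ^ 2 / 8))) ⊤ μ :=
    memLp_top_exp (memLp_top_mul ho (memLp_top_sub (memLp_top_mul hl (memLp_top_sub hy heL)) hl2))
  have hchordL : MemLp (fun ω => w ω * ((u ω - 1) + y ω * (v ω - u ω))) ⊤ μ :=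
    memLp_top_mul hw (memLp_top_add (memLp_top_sub huL (memLp_const 1)) (memLp_top_mul hy hvu))
  have hoc := memLp_top_mul ho hchordL
  -- Two chords, first in `o` and then in `y`, make the bound affine in each, so conditional
  -- expectations can replace them.
  have h1 : ∀ᵐ ω ∂μ, w ω * Real.exp (o ω * (l ω * (y ω - e ω) - l ω ^ 2 / 8)) ≤
      w ω + o ω * (w ω * ((u ω - 1) + y ω * (v ω - u ω))) := by
    filter_upwards [hw0] with ω hw0
    have h := convexOn_exp.2 (Set.mem_univ 0)
      (Set.mem_univ (l ω * (y ω - e ω) - l ω ^ 2 / 8)) (sub_nonneg.2 (ho1 ω).2) (ho1 ω).1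
      (by ring)
    simp only [smul_eq_mul, mul_zero, zero_add, Real.exp_zero, mul_one] at h
    have hc := mul_le_mul_of_nonneg_left
      (exp_le_chord (l ω) (e ω) (y ω) (hy1 ω).1 (hy1 ω).2) (ho1 ω).1
    have := mul_le_mul_of_nonneg_left (h.trans (add_le_add_right hc _)) hw0
    refine this.trans (le_of_eq ?_)
    simp only [hu, hv]
    ring
  have h2 : ∫ ω, o ω * (w ω * ((u ω - 1) + y ω * (v ω - u ω))) ∂μ ≤ 0 := by
    have hwqm := hwm.mul hqm
    have hwqL := memLp_top_mul hw hq
    -- Conditioning on `n`, where `y` is known, turns `o` into `q`; conditioning on `m` then turns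
    -- `y` into `e`.
    calc ∫ ω, o ω * (w ω * ((u ω - 1) + y ω * (v ω - u ω))) ∂μ
        = ∫ ω, (μ[o|n]) ω * (w ω * ((u ω - 1) + y ω * (v ω - u ω))) ∂μ :=
          integral_mul_eq_integral_condExp_mul hn ho hchordL <| (hwm.mono hmn).mul
            (((hum.mono hmn).sub stronglyMeasurable_const).add
              (hyn.mul ((hvm.mono hmn).sub (hum.mono hmn))))
      _ = ∫ ω, (w ω * q ω * (u ω - 1) + y ω * (w ω * q ω * (v ω - u ω))) ∂μ := by
          refine integral_congr_ae (hoq.mono fun ω h => ?_)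
          simp only [h]
          ring
      _ = ∫ ω, w ω * q ω * (u ω - 1) ∂μ + ∫ ω, e ω * (w ω * q ω * (v ω - u ω)) ∂μ := by
          rw [integral_add ((memLp_top_mul hwqL hu1).integrable le_top)
            ((memLp_top_mul hy (memLp_top_mul hwqL hvu)).integrable le_top)]
          congr 1
          exact integral_mul_eq_integral_condExp_mul hm hy (memLp_top_mul hwqL hvu)
            (hwqm.mul (hvm.sub hum))
      _ = ∫ ω, (w ω * q ω * (u ω - 1) + e ω * (w ω * q ω * (v ω - u ω))) ∂μ :=
          (integral_add ((memLp_top_mul hwqL hu1).integrable le_top)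
            ((memLp_top_mul heL (memLp_top_mul hwqL hvu)).integrable le_top)).symm
      _ ≤ 0 := by
          refine integral_nonpos_of_ae ?_
          filter_upwards [hw0, hq0, he1] with ω hw0 hq0 he1
          have h := chord_mean_le (l ω) (e ω) he1.1 he1.2
          have : w ω * q ω * (u ω - 1) + e ω * (w ω * q ω * (v ω - u ω)) =
            w ω * q ω * ((1 - e ω) * u ω + e ω * v ω - 1) := by ring
          rw [this]
          exact mul_nonpos_of_nonneg_of_nonpos (mul_nonneg hw0 hq0) (sub_nonpos.2 h)
  calc _ ≤ ∫ ω, (w ω + o ω * (w ω * ((u ω - 1) + y ω * (v ω - u ω)))) ∂μ :=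
        integral_mono_ae ((memLp_top_mul hw hexpL).integrable le_top)
          ((memLp_top_add hw hoc).integrable le_top) h1
    _ = ∫ ω, w ω ∂μ + ∫ ω, o ω * (w ω * ((u ω - 1) + y ω * (v ω - u ω))) ∂μ :=
        integral_add (hw.integrable le_top) (hoc.integrable le_top)
    _ ≤ _ := by linarith

/-- A variational lower bound for the expected increase of `∫ p log p` when the conditioning
σ-algebra grows. -/
lemma integral_mul_le_integral_mul_log_sub (hm' : m' ≤ mΩ) (hmm' : m ≤ m')
    {b x : Ω → ℝ} (hb : MemLp b ⊤ μ) (hb1 : ∀ ω, b ω ∈ Set.Icc 0 1)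
    (hx : MemLp x ⊤ μ) (hxm : StronglyMeasurable[m'] x)
    (hexp : ∀ w : Ω → ℝ, MemLp w ⊤ μ → StronglyMeasurable[m] w → (∀ᵐ ω ∂μ, 0 ≤ w ω) →
      ∫ ω, w ω * Real.exp (x ω) ∂μ ≤ ∫ ω, w ω ∂μ) :
    ∫ ω, b ω * x ω ∂μ ≤ ∫ ω, (μ[b|m']) ω * Real.log ((μ[b|m']) ω) ∂μ
      - ∫ ω, (μ[b|m]) ω * Real.log ((μ[b|m]) ω) ∂μ := by
  have hm := hmm'.trans hm'
  set α : Ω → ℝ := μ[b|m] with hα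
  set β : Ω → ℝ := μ[b|m'] with hβ
  have hαm : StronglyMeasurable[m] α := stronglyMeasurable_condExp
  have hβm : StronglyMeasurable[m'] β := stronglyMeasurable_condExp
  have hα1 : ∀ᵐ ω ∂μ, α ω ∈ Set.Icc 0 1 := condExp_ae_mem_Icc hm hb (.of_forall hb1)
  have hβ1 : ∀ᵐ ω ∂μ, β ω ∈ Set.Icc 0 1 := condExp_ae_mem_Icc hm' hb (.of_forall hb1)
  have hαL : MemLp α ⊤ μ := memLp_top_of_ae_mem_Icc (hαm.mono hm).aestronglyMeasurable hα1
  have hβL : MemLp β ⊤ μ := memLp_top_of_ae_mem_Icc (hβm.mono hm').aestronglyMeasurable hβ1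
  have hφα := memLp_top_mul_log hαL.1 hα1
  have hφβ := memLp_top_mul_log hβL.1 hβ1
  refine le_of_forall_pos_le_add fun δ hδ => ?_
  -- The floor `δ` keeps log α bounded where the posterior vanishes; it costs at most `δ` in the
  -- end.
  set d : Ω → ℝ := fun ω => max (α ω) δ with hd
  have hd0 : ∀ ω, 0 < d ω := fun ω => hδ.trans_le (le_max_right _ _)
  have hdm : StronglyMeasurable[m] d := (hαm.measurable.max measurable_const).stronglyMeasurable
  have hdL : MemLp d ⊤ μ := by
    refine memLp_top_of_ae_mem_Icc (a := 0) (b := max 1 δ) (hdm.mono hm).aestronglyMeasurable ?_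
    filter_upwards [hα1] with ω h
    exact ⟨(hd0 ω).le, max_le_max_right δ h.2⟩
  set g : Ω → ℝ := fun ω => Real.log (d ω) with hg
  have hgm : StronglyMeasurable[m] g := hdm.measurable.log.stronglyMeasurable
  have hgL : MemLp g ⊤ μ := by
    refine memLp_top_of_ae_mem_Icc (a := Real.log δ) (b := Real.log (max 1 δ))
      (hgm.mono hm).aestronglyMeasurable ?_
    filter_upwards [hα1] with ω h
    exact ⟨Real.log_le_log hδ (le_max_right _ _),
      Real.log_le_log (hd0 ω) (max_le_max_right δ h.2)⟩
  have hdeL := memLp_top_mul hdL (memLp_top_exp hx)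
  have hβx : ∫ ω, b ω * x ω ∂μ = ∫ ω, β ω * x ω ∂μ :=
    integral_mul_eq_integral_condExp_mul hm' hb hx hxm
  -- Tower property: `g` is known at `m`, so both sides are the integral of `b` against 1 + `g`.
  have hβg : ∫ ω, β ω * (1 + g ω) ∂μ = ∫ ω, α ω * (1 + g ω) ∂μ := by
    have h1L := memLp_top_add (memLp_const (1 : ℝ)) hgL
    have h1m : StronglyMeasurable[m] (fun ω => 1 + g ω) := stronglyMeasurable_const.add hgm
    rw [← integral_mul_eq_integral_condExp_mul hm' hb h1L (h1m.mono hmm'),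
      ← integral_mul_eq_integral_condExp_mul hm hb h1L h1m]
  have h1 : ∫ ω, β ω * (1 + g ω) ∂μ + ∫ ω, β ω * x ω ∂μ - ∫ ω, d ω * Real.exp (x ω) ∂μ ≤
      ∫ ω, β ω * Real.log (β ω) ∂μ := by
    have i1 := (memLp_top_mul hβL (memLp_top_add (memLp_const (1 : ℝ)) hgL)).integrable le_top
    have i2 := (memLp_top_mul hβL hx).integrable le_top
    have i3 := hdeL.integrable le_top
    have i12 : Integrable (fun ω => β ω * (1 + g ω) + β ω * x ω) μ := i1.add i2
    rw [← integral_add i1 i2, ← integral_sub i12 i3]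
    refine integral_mono_ae (i12.sub i3) (hφβ.integrable le_top) ?_
    filter_upwards [hβ1] with ω h
    have hf := fenchel_mul_log (β ω) (g ω + x ω) h.1
    rw [Real.exp_add, Real.exp_log (hd0 ω)] at hf
    refine le_trans (le_of_eq ?_) hf
    ring
  have h2 : ∫ ω, α ω * Real.log (α ω) ∂μ + ∫ ω, d ω ∂μ ≤ ∫ ω, α ω * (1 + g ω) ∂μ + δ := by
    have i1 := (memLp_top_mul hαL (memLp_top_add (memLp_const (1 : ℝ)) hgL)).integrable le_top
    rw [← integral_add (hφα.integrable le_top) (hdL.integrable le_top)]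
    have : ∫ ω, α ω * (1 + g ω) ∂μ + δ = ∫ ω, (α ω * (1 + g ω) + δ) ∂μ := by
      rw [integral_add i1 (integrable_const δ)]
      simp
    rw [this]
    refine integral_mono_ae ((memLp_top_add hφα hdL).integrable le_top) (i1.add (integrable_const δ)) ?_
    filter_upwards [hα1] with ω h
    have hdle : d ω ≤ α ω + δ := max_le (by linarith) (by linarith [h.1])
    have hlog : α ω * Real.log (α ω) ≤ α ω * g ω := by
      rcases h.1.eq_or_lt with h0 | h0
      · simp [← h0]
      · exact mul_le_mul_of_nonneg_left (Real.log_le_log h0 (le_max_left _ _)) h.1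
    show α ω * Real.log (α ω) + d ω ≤ α ω * (1 + g ω) + δ
    linarith
  have h3 := hexp d hdL hdm (.of_forall fun ω => (hd0 ω).le)
  linarith

end Conditioning

/-! ### Covariance against information gain -/

section Information

variable {Ω : Type*} {m m' n mΩ : MeasurableSpace Ω} {μ : Measure Ω} [IsProbabilityMeasure μ]

/-- The price of replacing 1/q by the bounded 1/max(q, ε): since α ≤ q, the mass lost where q < ε is
at most ε, and the quadratic term does not grow. -/
lemma cutoff_bounds {α q ε : ℝ} (hε : 0 < ε) (hα : 0 ≤ α) (hαq : α ≤ q) :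
    α * (1 - q / max q ε) ≤ ε ∧ α * (q * (1 / max q ε) ^ 2) ≤ α / q := by
  rcases le_total ε q with h | h
  · have hq := hε.trans_le h
    rw [max_eq_left h, div_self hq.ne']
    refine ⟨by linarith, le_of_eq ?_⟩
    field_simp
  · rw [max_eq_right h]
    have hq := hα.trans hαq
    constructor
    · have : 0 ≤ q / ε := by positivity
      nlinarith
    · rcases hq.eq_or_lt with rfl | hq
      · simp
      · rw [div_eq_mul_one_div α q]
        refine mul_le_mul_of_nonneg_left ?_ hα
        rw [div_pow, one_pow, mul_one_div, div_le_div_iff₀ (by positivity) hq]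
        nlinarith

/-- The covariance of `b` and `y` given `m` is controlled by the information about `b` gained by
passing from `m` to `m'`, when `m'` reveals `y` with conditional probability `q`. -/
lemma mul_integral_mul_sub_condExp_le (hm' : m' ≤ mΩ) (hn : n ≤ mΩ) (hmm' : m ≤ m') (hmn : m ≤ n)
    {b q o y : Ω → ℝ}
    (hb : MemLp b ⊤ μ) (hbn : StronglyMeasurable[n] b) (hb1 : ∀ ω, b ω ∈ Set.Icc 0 1)
    (hy : MemLp y ⊤ μ) (hyn : StronglyMeasurable[n] y) (hy1 : ∀ ω, y ω ∈ Set.Icc 0 1)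
    (ho1 : ∀ ω, o ω ∈ Set.Icc 0 1) (hom : StronglyMeasurable[m'] o)
    (hoym : StronglyMeasurable[m'] fun ω => o ω * y ω)
    (hqm : StronglyMeasurable[m] q) (hoq : μ[o|n] =ᵐ[μ] q) (hbq : μ[b|m] ≤ᵐ[μ] q)
    {c ε : ℝ} (hc : 0 < c) (hε : 0 < ε) :
    c * ∫ ω, b ω * (y ω - (μ[y|m]) ω) ∂μ ≤
      ∫ ω, (μ[b|m']) ω * Real.log ((μ[b|m']) ω) ∂μ
        - ∫ ω, (μ[b|m]) ω * Real.log ((μ[b|m]) ω) ∂μ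
        + c ^ 2 / 8 * ∫ ω, (μ[b|m]) ω / q ω ∂μ + c * ε := by
  have hm := hmm'.trans hm'
  have ho : MemLp o ⊤ μ :=
    memLp_top_of_ae_mem_Icc (hom.mono hm').aestronglyMeasurable (.of_forall ho1)
  have hq1 : ∀ᵐ ω ∂μ, q ω ∈ Set.Icc 0 1 := by
    filter_upwards [condExp_ae_mem_Icc hn ho (.of_forall ho1), hoq] with ω h1 h2
    rwa [← h2]
  have hq : MemLp q ⊤ μ := memLp_top_of_ae_mem_Icc (hqm.mono hm).aestronglyMeasurable hq1
  set e : Ω → ℝ := μ[y|m] with he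
  have hem : StronglyMeasurable[m] e := stronglyMeasurable_condExp
  have he1 : ∀ᵐ ω ∂μ, e ω ∈ Set.Icc 0 1 := condExp_ae_mem_Icc hm hy (.of_forall hy1)
  have heL : MemLp e ⊤ μ := memLp_top_of_ae_mem_Icc (hem.mono hm).aestronglyMeasurable he1
  set r : Ω → ℝ := fun ω => 1 / max (q ω) ε with hr
  have hrm : StronglyMeasurable[m] r :=
    ((hqm.measurable.max measurable_const).const_div 1).stronglyMeasurable
  have hr0 : ∀ ω, 0 ≤ r ω := fun ω => by
    have : 0 < max (q ω) ε := hε.trans_le (le_max_right _ _)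
    positivity
  have hrL : MemLp r ⊤ μ := memLp_top_of_ae_mem_Icc (a := 0) (b := 1 / ε)
    (hrm.mono hm).aestronglyMeasurable
    (.of_forall fun ω => ⟨hr0 ω, one_div_le_one_div_of_le hε (le_max_right _ _)⟩)
  -- Scaling by the truncated inverse of `q` compensates for the chance of not observing `y`: `q *
  -- l` equals `c` wherever `q ≥ ε`.
  set l : Ω → ℝ := fun ω => c * r ω with hl
  have hlm : StronglyMeasurable[m] l := (hrm.measurable.const_mul c).stronglyMeasurable
  have hlL : MemLp l ⊤ μ := hrL.const_mul c
  set l2 : Ω → ℝ := fun ω => l ω ^ 2 / 8 with hl2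
  have hl2m : StronglyMeasurable[m] l2 :=
    ((hlm.measurable.pow_const 2).div_const 8).stronglyMeasurable
  have hl2L : MemLp l2 ⊤ μ := by
    simpa only [hl2, sq, mul_div_assoc, div_eq_inv_mul]
      using (memLp_top_mul hlL hlL).const_mul (8 : ℝ)⁻¹
  set ξ : Ω → ℝ := fun ω => l ω * (y ω - e ω) - l2 ω with hξ
  have hξL : MemLp ξ ⊤ μ := memLp_top_sub (memLp_top_mul hlL (memLp_top_sub hy heL)) hl2L
  have hξn : StronglyMeasurable[n] ξ :=
    ((hlm.mono hmn).mul (hyn.sub (hem.mono hmn))).sub (hl2m.mono hmn)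
  have hxm : StronglyMeasurable[m'] fun ω => o ω * ξ ω := by
    have h := ((hlm.mono hmm').mul (hoym.sub (hom.mul (hem.mono hmm')))).sub
      (hom.mul (hl2m.mono hmm'))
    convert h using 1
    ext ω
    simp only [hξ, Pi.sub_apply, Pi.mul_apply]
    ring
  have hgain := integral_mul_le_integral_mul_log_sub hm' hmm' hb hb1 (memLp_top_mul ho hξL) hxm
    fun w hwL hwm hw0 => integral_mul_exp_le hm hn hmn hwL hwm hw0 hlL hlm hq hqm
      (hq1.mono fun ω h => h.1) ho ho1 hoq hy hyn hy1
  set α : Ω → ℝ := μ[b|m] with hα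
  have hαm : StronglyMeasurable[m] α := stronglyMeasurable_condExp
  have hα1 : ∀ᵐ ω ∂μ, α ω ∈ Set.Icc 0 1 := condExp_ae_mem_Icc hm hb (.of_forall hb1)
  have hαL : MemLp α ⊤ μ := memLp_top_of_ae_mem_Icc (hαm.mono hm).aestronglyMeasurable hα1
  have hαqL : MemLp (fun ω => α ω / q ω) ⊤ μ := by
    refine memLp_top_of_ae_mem_Icc (a := 0) (b := 1)
      (hαm.measurable.div hqm.measurable |>.stronglyMeasurable.mono hm).aestronglyMeasurable ?_
    filter_upwards [hα1, hq1, hbq] with ω h1 h2 h3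
    exact ⟨div_nonneg h1.1 h2.1, div_le_one_of_le₀ h3 h2.1⟩
  -- Both `b` and `ξ` are known at `n`, so only `o` is averaged.
  have hbξ : ∫ ω, b ω * (o ω * ξ ω) ∂μ = ∫ ω, b ω * (q ω * ξ ω) ∂μ := by
    have h := integral_mul_eq_integral_condExp_mul hn ho (memLp_top_mul hb hξL) (hbn.mul hξn)
    calc _ = ∫ ω, o ω * (b ω * ξ ω) ∂μ := by congr 1; ext ω; ring
      _ = ∫ ω, (μ[o|n]) ω * (b ω * ξ ω) ∂μ := h
      _ = _ := integral_congr_ae (hoq.mono fun ω h => by simp only [h]; ring)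
  set s : Ω → ℝ := fun ω => c * (1 - q ω * r ω) + q ω * l2 ω with hs
  have hsm : StronglyMeasurable[m] s :=
    (((measurable_const.sub (hqm.measurable.mul hrm.measurable)).const_mul c).add
      (hqm.measurable.mul hl2m.measurable)).stronglyMeasurable
  have hsL : MemLp s ⊤ μ := memLp_top_add
    ((memLp_top_sub (memLp_const 1) (memLp_top_mul hq hrL)).const_mul c) (memLp_top_mul hq hl2L)
  have hbyL := (memLp_top_mul hb (memLp_top_sub hy heL)).const_mul c
  have hbqξL := memLp_top_mul hb (memLp_top_mul hq hξL)
  have h1 : c * ∫ ω, b ω * (y ω - e ω) ∂μ ≤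
      ∫ ω, b ω * (q ω * ξ ω) ∂μ + ∫ ω, b ω * s ω ∂μ := by
    rw [← integral_const_mul, ← integral_add (hbqξL.integrable le_top)
      ((memLp_top_mul hb hsL).integrable le_top)]
    refine integral_mono_ae (hbyL.integrable le_top)
      ((memLp_top_add hbqξL (memLp_top_mul hb hsL)).integrable le_top) ?_
    filter_upwards [he1, hq1] with ω he1 hq1
    have hqr : q ω * r ω ≤ 1 := by
      rw [hr, mul_one_div]
      exact div_le_one_of_le₀ (le_max_left _ _) (hε.le.trans (le_max_right _ _))
    -- This product is exactly the slack of the inequality, nonnegative because `y - e ≤ 1`.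
    have h : 0 ≤ c * b ω * ((1 - q ω * r ω) * (1 - (y ω - e ω))) :=
      mul_nonneg (mul_nonneg hc.le (hb1 ω).1)
        (mul_nonneg (sub_nonneg.2 hqr) (by linarith [(hy1 ω).2, he1.1]))
    have : b ω * (q ω * ξ ω) + b ω * s ω - c * (b ω * (y ω - e ω)) =
        c * b ω * ((1 - q ω * r ω) * (1 - (y ω - e ω))) := by
      simp only [hξ, hs, hl]
      ring
    linarith
  have h2 : ∫ ω, b ω * s ω ∂μ ≤ c ^ 2 / 8 * ∫ ω, α ω / q ω ∂μ + c * ε := by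
    rw [integral_mul_eq_integral_condExp_mul hm hb hsL hsm, ← integral_const_mul]
    have hi := (hαqL.const_mul (c ^ 2 / 8)).integrable le_top
    have : ∫ ω, c ^ 2 / 8 * (α ω / q ω) ∂μ + c * ε =
        ∫ ω, (c ^ 2 / 8 * (α ω / q ω) + c * ε) ∂μ := by
      rw [integral_add hi (integrable_const _)]
      simp
    rw [this]
    refine integral_mono_ae ((memLp_top_mul hαL hsL).integrable le_top)
      (hi.add (integrable_const _)) ?_
    filter_upwards [hα1, hbq] with ω h1 h2
    obtain ⟨h3, h4⟩ := cutoff_bounds hε h1.1 h2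
    have h5 := mul_le_mul_of_nonneg_left h3 hc.le
    have h6 := mul_le_mul_of_nonneg_left h4 (show 0 ≤ c ^ 2 / 8 by positivity)
    refine le_trans (le_of_eq ?_) (add_le_add h6 h5)
    simp only [hs, hl2, hl, hr]
    ring
  linarith

end Information

/-! ### Measurability, posterior and entropy in the bandit model -/

namespace BayesianBandit

variable {K : ℕ} {Ω : Type*} [mΩ : MeasurableSpace Ω] {μ : Measure Ω}
  (M : BayesianBandit K μ) {G : ℕ → Digraph (Fin K)} {A : ℕ → Ω → Fin K}

lemma measurable_observation (hA : ∀ t, Measurable (A t)) (t : ℕ) :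
    Measurable (M.observation G A t) := by
  classical
  refine (hA t).prodMk (measurable_pi_lambda _ fun a => ?_)
  refine Measurable.ite ?_ ((measurable_pi_apply a).comp (M.measurable_Y t)) measurable_const
  exact hA t (.of_discrete (s := {k | a = k ∨ (G t).Adj k a}))

lemma history_le (hA : ∀ t, Measurable (A t)) (t : ℕ) : M.history G A t ≤ mΩ :=
  iSup₂_le fun s _ => (M.measurable_observation hA s).comap_le

lemma environment_le : M.environment ≤ mΩ :=
  sup_le (sup_le M.measurable_pStar.comap_le M.measurable_AStar.comap_le)
    (iSup_le fun t => (M.measurable_Y t).comap_le)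

lemma history_le_succ (t : ℕ) : M.history G A t ≤ M.history G A (t + 1) :=
  biSup_mono fun s hs => by
    rw [Finset.mem_range] at hs ⊢
    omega

lemma measurable_observation_history (t : ℕ) :
    Measurable[M.history G A (t + 1)] (M.observation G A t) :=
  (comap_measurable _).mono
    (le_biSup (fun s => MeasurableSpace.comap (M.observation G A s) inferInstance)
      (Finset.self_mem_range_succ t)) le_rfl

lemma measurable_AStar_environment : Measurable[M.environment] M.AStar :=
  (comap_measurable _).mono (le_sup_right.trans le_sup_left) le_rfl

lemma measurable_Y_environment (t : ℕ) : Measurable[M.environment] (M.Y t) :=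
  (comap_measurable _).mono
    ((le_iSup (fun t => MeasurableSpace.comap (M.Y t) inferInstance) t).trans le_sup_right) le_rfl

/-- The reward of action `a` in round `t`, as a real random variable. -/
noncomputable def reward (t : ℕ) (a : Fin K) (ω : Ω) : ℝ := M.Y t ω a

lemma measurable_reward_environment (t : ℕ) (a : Fin K) :
    Measurable[M.environment] (M.reward t a) :=
  measurable_subtype_coe.comp ((measurable_pi_apply a).comp (M.measurable_Y_environment t))

lemma reward_mem_Icc (t : ℕ) (a : Fin K) (ω : Ω) : M.reward t a ω ∈ Set.Icc (0 : ℝ) 1 :=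
  (M.Y t ω a).2

lemma memLp_reward (t : ℕ) (a : Fin K) : MemLp (M.reward t a) ⊤ μ :=
  memLp_top_of_ae_mem_Icc
    ((M.measurable_reward_environment t a).mono M.environment_le le_rfl).aestronglyMeasurable
    (.of_forall (M.reward_mem_Icc t a))

/-- The indicator of the event `{X = a}`. -/
noncomputable def hit (X : Ω → Fin K) (a : Fin K) : Ω → ℝ := (X ⁻¹' {a}).indicator fun _ => 1

omit mΩ in
lemma hit_apply (X : Ω → Fin K) (a : Fin K) (ω : Ω) : hit X a ω = if X ω = a then 1 else 0 := by
  classical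
  simp [hit, Set.indicator_apply]

omit mΩ in
lemma hit_mem_Icc (X : Ω → Fin K) (a : Fin K) (ω : Ω) : hit X a ω ∈ Set.Icc (0 : ℝ) 1 := by
  rw [hit_apply]
  split_ifs <;> simp

omit mΩ in
lemma measurable_hit {m : MeasurableSpace Ω} {X : Ω → Fin K} (hX : Measurable[m] X) (a : Fin K) :
    Measurable[m] (hit X a) :=
  measurable_const.indicator (hX (measurableSet_singleton a))

lemma memLp_hit {X : Ω → Fin K} (hX : Measurable X) (a : Fin K) : MemLp (hit X a) ⊤ μ :=
  memLp_top_of_ae_mem_Icc (measurable_hit hX a).aestronglyMeasurable (.of_forall (hit_mem_Icc X a))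

variable (G A) in
open Classical in
/-- The conditional probability given the history that the reward of `a` is observed. -/
noncomputable def revealProb (t : ℕ) (a : Fin K) (ω : Ω) : ℝ :=
  ∑ k with (k = a ∨ (G t).Adj k a), M.posterior G A t k ω

variable (G A) in
/-- The expected negative entropy of the posterior distribution in round `t`. -/
noncomputable def negEntropy (t : ℕ) : ℝ :=
  ∑ a, ∫ ω, M.posterior G A t a ω * Real.log (M.posterior G A t a ω) ∂μ

variable [IsProbabilityMeasure μ]

lemma posterior_mem_Icc (hA : ∀ t, Measurable (A t)) (t : ℕ) :
    ∀ᵐ ω ∂μ, ∀ a, M.posterior G A t a ω ∈ Set.Icc (0 : ℝ) 1 :=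
  ae_all_iff.2 fun a => condExp_ae_mem_Icc (M.history_le hA t) (memLp_hit M.measurable_AStar a)
    (.of_forall (hit_mem_Icc M.AStar a))

lemma negEntropy_nonpos (hA : ∀ t, Measurable (A t)) (t : ℕ) : M.negEntropy G A t ≤ 0 := by
  refine Finset.sum_nonpos fun a _ => integral_nonpos_of_ae ?_
  filter_upwards [M.posterior_mem_Icc (G := G) hA t] with ω h
  exact Real.mul_log_nonpos (h a).1 (h a).2

lemma negEntropy_zero : M.negEntropy G A 0 = - shannonEntropy M.prior := by
  rw [negEntropy, shannonEntropy, neg_neg]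
  refine Finset.sum_congr rfl fun a _ => ?_
  have h : M.posterior G A 0 a = fun _ => M.prior a := by
    -- Before round 0 nothing is known, so the posterior is the constant prior.
    have hbot : M.history G A 0 = ⊥ := by simp [history]
    rw [posterior, hbot, condExp_bot, prior,
      integral_indicator_const _ (M.measurable_AStar (measurableSet_singleton a))]
    simp
  simp [h]

open Classical in
-- The reward of `a` is seen exactly when the action played lies in the closed in-neighbourhood of
-- `a`; the sampling rule turns each action's indicator into its posterior weight, even given the
-- environment.
lemma condExp_observed_ae_eq (hA : M.IsTSN G A) (t : ℕ) (a : Fin K) :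
    μ[fun ω => ∑ k with (k = a ∨ (G t).Adj k a), hit (A t) k ω | M.history G A t ⊔ M.environment]
      =ᵐ[μ] M.revealProb G A t a := by
  have h := condExp_finsetSum (μ := μ) (m := M.history G A t ⊔ M.environment)
    (s := Finset.univ.filter fun k => k = a ∨ (G t).Adj k a) (f := fun k => hit (A t) k)
    fun k _ => (memLp_hit (hA.measurable_action t) k).integrable le_top
  have hk : ∀ᵐ ω ∂μ, ∀ k, (μ[hit (A t) k | M.history G A t ⊔ M.environment]) ω =
    M.posterior G A t k ω := ae_all_iff.2 fun k => hA.sampling t k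
  have heq : (fun ω => ∑ k with (k = a ∨ (G t).Adj k a), hit (A t) k ω) =
      ∑ k with (k = a ∨ (G t).Adj k a), hit (A t) k := by
    ext ω
    simp
  rw [heq]
  filter_upwards [h, hk] with ω h hk
  rw [h, revealProb, Finset.sum_apply]
  exact Finset.sum_congr rfl fun k _ => hk k

lemma posterior_le_revealProb (hA : ∀ t, Measurable (A t)) (t : ℕ) (a : Fin K) :
    M.posterior G A t a ≤ᵐ[μ] M.revealProb G A t a := by
  classical
  filter_upwards [M.posterior_mem_Icc (G := G) hA t] with ω h
  exact Finset.single_le_sum (f := fun k => M.posterior G A t k ω) (fun k _ => (h k).1) (by simp)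

/-- The general bound with `m`, `m'` the histories before and after the round and `n` the earlier
history joined with the environment. -/
lemma mul_covariance_le (hA : M.IsTSN G A) (t : ℕ) (a : Fin K) {c ε : ℝ} (hc : 0 < c)
    (hε : 0 < ε) :
    c * ∫ ω, hit M.AStar a ω * (M.reward t a ω - (μ[M.reward t a | M.history G A t]) ω) ∂μ ≤
      ∫ ω, M.posterior G A (t + 1) a ω * Real.log (M.posterior G A (t + 1) a ω) ∂μ
        - ∫ ω, M.posterior G A t a ω * Real.log (M.posterior G A t a ω) ∂μ
        + c ^ 2 / 8 * ∫ ω, M.posterior G A t a ω / M.revealProb G A t a ω ∂μ + c * ε := by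
  classical
  have hAm := hA.measurable_action
  have hobs : ∀ ω, ∑ k with (k = a ∨ (G t).Adj k a), hit (A t) k ω =
      if A t ω = a ∨ (G t).Adj (A t ω) a then 1 else 0 := by
    intro ω
    simp only [hit_apply, Finset.sum_ite_eq, Finset.mem_filter, Finset.mem_univ, true_and]
  have hX := M.measurable_observation_history (G := G) (A := A) t
  have hAt : Measurable[M.history G A (t + 1)] (A t) := measurable_fst.comp hX
  have ho : Measurable[M.history G A (t + 1)]
      fun ω => ∑ k with (k = a ∨ (G t).Adj k a), hit (A t) k ω :=
    Finset.measurable_fun_sum _ fun k _ => measurable_hit hAt k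
  have hoy : Measurable[M.history G A (t + 1)]
      fun ω => (∑ k with (k = a ∨ (G t).Adj k a), hit (A t) k ω) * M.reward t a ω := by
    have h : Measurable[M.history G A (t + 1)] fun ω => ((M.observation G A t ω).2 a : ℝ) :=
      measurable_subtype_coe.comp ((measurable_pi_apply a).comp (measurable_snd.comp hX))
    -- Unobserved rewards are recorded as 0, so the recorded coordinate is exactly the indicator
    -- times the reward.
    convert h using 1
    ext ω
    rw [hobs, observation, reward]
    dsimp only
    by_cases h : A t ω = a ∨ (G t).Adj (A t ω) a
    · rw [if_pos h, if_pos (h.imp_left Eq.symm), one_mul]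
    · rw [if_neg h, if_neg (mt (Or.imp_left Eq.symm) h), zero_mul]
      rfl
  have hE : M.environment ≤ M.history G A t ⊔ M.environment := le_sup_right
  exact mul_integral_mul_sub_condExp_le (M.history_le hAm (t + 1))
    (sup_le (M.history_le hAm t) M.environment_le) (M.history_le_succ t) le_sup_left
    (memLp_hit M.measurable_AStar a)
    ((measurable_hit M.measurable_AStar_environment a).mono hE le_rfl).stronglyMeasurable
    (hit_mem_Icc M.AStar a) (M.memLp_reward t a)
    ((M.measurable_reward_environment t a).mono hE le_rfl).stronglyMeasurable
    (M.reward_mem_Icc t a)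
    (fun ω => by rw [hobs]; split_ifs <;> simp) ho.stronglyMeasurable hoy.stronglyMeasurable
    (Finset.measurable_fun_sum _ fun k _ =>
      stronglyMeasurable_condExp.measurable).stronglyMeasurable
    (M.condExp_observed_ae_eq hA t a) (M.posterior_le_revealProb hAm t a) hc hε

/-! ### Regret decomposition and summation -/

/-- The reward of the action of round `t` has the same mean as that of an action drawn from the
posterior independently of the rewards. -/
lemma integral_hit_mul_reward (hA : M.IsTSN G A) (t : ℕ) (a : Fin K) :
    ∫ ω, hit (A t) a ω * M.reward t a ω ∂μ =
      ∫ ω, hit M.AStar a ω * (μ[M.reward t a | M.history G A t]) ω ∂μ := by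
  have hAm := hA.measurable_action
  have hm := M.history_le (G := G) hAm t
  have hE : M.environment ≤ M.history G A t ⊔ M.environment := le_sup_right
  have hαm : StronglyMeasurable[M.history G A t] (M.posterior G A t a) :=
    stronglyMeasurable_condExp
  have hαL : MemLp (M.posterior G A t a) ⊤ μ :=
    memLp_top_of_ae_mem_Icc (hαm.mono hm).aestronglyMeasurable
      ((M.posterior_mem_Icc hAm t).mono fun ω h => h a)
  have heL : MemLp (μ[M.reward t a | M.history G A t]) ⊤ μ :=
    memLp_top_of_ae_mem_Icc (stronglyMeasurable_condExp.mono hm).aestronglyMeasurable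
      (condExp_ae_mem_Icc hm (M.memLp_reward t a) (.of_forall (M.reward_mem_Icc t a)))
  rw [integral_mul_eq_integral_condExp_mul (sup_le hm M.environment_le)
    (memLp_hit (hAm t) a) (M.memLp_reward t a)
    ((M.measurable_reward_environment t a).mono hE le_rfl).stronglyMeasurable]
  calc _ = ∫ ω, M.reward t a ω * M.posterior G A t a ω ∂μ :=
        integral_congr_ae ((hA.sampling t a).mono fun ω h => by
          rw [mul_comm]
          exact congrArg _ h)
    _ = ∫ ω, (μ[M.reward t a | M.history G A t]) ω * M.posterior G A t a ω ∂μ :=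
        integral_mul_eq_integral_condExp_mul hm (M.memLp_reward t a) hαL hαm
    _ = ∫ ω, M.posterior G A t a ω * (μ[M.reward t a | M.history G A t]) ω ∂μ := by
        simp only [mul_comm]
    _ = _ := (integral_mul_eq_integral_condExp_mul hm (memLp_hit M.measurable_AStar a) heL
        stronglyMeasurable_condExp).symm

omit [IsProbabilityMeasure μ] in
lemma reward_eq_sum (t : ℕ) (X : Ω → Fin K) (ω : Ω) :
    (M.Y t ω (X ω) : ℝ) = ∑ a, hit X a ω * M.reward t a ω := by
  simp [hit_apply, reward]

lemma bayesRegret_eq (hA : M.IsTSN G A) (T : ℕ) :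
    M.bayesRegret A T = ∑ t ∈ Finset.range T, ∑ a,
      ∫ ω, hit M.AStar a ω * (M.reward t a ω - (μ[M.reward t a | M.history G A t]) ω) ∂μ := by
  have hAm := hA.measurable_action
  have hi : ∀ {X : Ω → Fin K}, Measurable X → ∀ t a,
      Integrable (fun ω => hit X a ω * M.reward t a ω) μ := fun hX t a =>
    (memLp_top_mul (memLp_hit hX a) (M.memLp_reward t a)).integrable le_top
  have hie : ∀ t a, Integrable
      (fun ω => hit M.AStar a ω * (μ[M.reward t a | M.history G A t]) ω) μ := fun t a =>
    (memLp_top_mul (memLp_hit M.measurable_AStar a) (memLp_top_of_ae_mem_Icc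
      (stronglyMeasurable_condExp.mono (M.history_le hAm t)).aestronglyMeasurable
      (condExp_ae_mem_Icc (M.history_le hAm t) (M.memLp_reward t a)
        (.of_forall (M.reward_mem_Icc t a))))).integrable le_top
  have hd : ∀ t a, Integrable
      (fun ω => hit M.AStar a ω * M.reward t a ω - hit (A t) a ω * M.reward t a ω) μ :=
    fun t a => (hi M.measurable_AStar t a).sub (hi (hAm t) t a)
  simp only [bayesRegret, reward_eq_sum, mul_sub, ← Finset.sum_sub_distrib]
  rw [integral_finsetSum _ fun t _ => integrable_finsetSum _ fun a _ => hd t a]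
  refine Finset.sum_congr rfl fun t _ => ?_
  rw [integral_finsetSum _ fun a _ => hd t a]
  refine Finset.sum_congr rfl fun a _ => ?_
  rw [integral_sub (hi M.measurable_AStar t a) (hi (hAm t) t a),
    integral_sub (hi M.measurable_AStar t a) (hie t a), M.integral_hit_mul_reward hA t a]

lemma sum_integral_posterior_div_le (hA : ∀ t, Measurable (A t)) (t : ℕ) :
    ∑ a, ∫ ω, M.posterior G A t a ω / M.revealProb G A t a ω ∂μ ≤ mas (G t) := by
  classical
  have hm := M.history_le (G := G) hA t
  have hi : ∀ a, Integrable (fun ω => M.posterior G A t a ω / M.revealProb G A t a ω) μ := by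
    intro a
    have hmeas : Measurable[M.history G A t]
        fun ω => M.posterior G A t a ω / M.revealProb G A t a ω :=
      stronglyMeasurable_condExp.measurable.div
        (Finset.measurable_fun_sum _ fun k _ => stronglyMeasurable_condExp.measurable)
    refine Integrable.of_mem_Icc 0 1 (hmeas.mono hm le_rfl).aemeasurable ?_
    filter_upwards [M.posterior_mem_Icc (G := G) hA t, M.posterior_le_revealProb hA t a]
      with ω h1 h2
    have h3 := (h1 a).1.trans h2
    exact ⟨div_nonneg (h1 a).1 h3, div_le_one_of_le₀ h2 h3⟩
  rw [← integral_finsetSum _ fun a _ => hi a]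
  calc _ ≤ ∫ _, (mas (G t) : ℝ) ∂μ := by
        refine integral_mono_ae (integrable_finsetSum _ fun a _ => hi a) (integrable_const _) ?_
        filter_upwards [M.posterior_mem_Icc (G := G) hA t] with ω h
        refine le_trans (le_of_eq (Finset.sum_congr rfl fun a _ => ?_))
          (sum_div_le_mas (G t) (fun a => M.posterior G A t a ω) fun a => (h a).1)
        rw [revealProb]
        congr!
    _ = _ := by simp

/-- Summing over actions turns the gains into differences of `negEntropy`, which telescope over
rounds; the cutoff errors total T K c ε and vanish as ε tends to 0. -/
lemma mul_bayesRegret_le (hA : M.IsTSN G A) (T : ℕ) {c : ℝ} (hc : 0 < c) :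
    c * M.bayesRegret A T ≤
      shannonEntropy M.prior + c ^ 2 / 8 * ∑ t ∈ Finset.range T, (mas (G t) : ℝ) := by
  have hAm := hA.measurable_action
  have key : ∀ ε > 0, c * M.bayesRegret A T ≤
      shannonEntropy M.prior + c ^ 2 / 8 * ∑ t ∈ Finset.range T, (mas (G t) : ℝ)
        + T * K * c * ε := by
    intro ε hε
    calc c * M.bayesRegret A T
        ≤ ∑ t ∈ Finset.range T, ((M.negEntropy G A (t + 1) - M.negEntropy G A t)
            + c ^ 2 / 8 * mas (G t) + K * (c * ε)) := by
          rw [M.bayesRegret_eq hA, Finset.mul_sum]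
          refine Finset.sum_le_sum fun t _ => ?_
          rw [Finset.mul_sum]
          refine (Finset.sum_le_sum fun a _ => M.mul_covariance_le hA t a hc hε).trans ?_
          rw [Finset.sum_add_distrib, Finset.sum_add_distrib, Finset.sum_sub_distrib,
            ← Finset.mul_sum]
          have h := mul_le_mul_of_nonneg_left (M.sum_integral_posterior_div_le (G := G) hAm t)
            (show 0 ≤ c ^ 2 / 8 by positivity)
          simp only [negEntropy, Finset.sum_const, Finset.card_univ, Fintype.card_fin, nsmul_eq_mul]
          linarith
      _ = M.negEntropy G A T - M.negEntropy G A 0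
            + c ^ 2 / 8 * ∑ t ∈ Finset.range T, (mas (G t) : ℝ) + T * K * c * ε := by
          rw [Finset.sum_add_distrib, Finset.sum_add_distrib, Finset.sum_range_sub,
            ← Finset.mul_sum]
          simp only [Finset.sum_const, Finset.card_range, nsmul_eq_mul]
          ring
      _ ≤ _ := by
          have h := M.negEntropy_nonpos (G := G) hAm T
          rw [negEntropy_zero]
          linarith
  refine le_of_forall_pos_le_add fun δ hδ => ?_
  -- The added 1 covers `T = 0` and `K = 0`.
  have hD : 0 < (T * K * c + 1 : ℝ) := by positivity
  refine (key (δ / (T * K * c + 1)) (by positivity)).trans ?_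
  have : (T * K * c : ℝ) * (δ / (T * K * c + 1)) ≤ δ := by
    rw [← mul_div_assoc, div_le_iff₀ hD]
    linarith
  linarith

lemma shannonEntropy_prior_nonneg : 0 ≤ shannonEntropy M.prior := by
  rw [shannonEntropy, neg_nonneg]
  exact Finset.sum_nonpos fun a _ => Real.mul_log_nonpos measureReal_nonneg measureReal_le_one

end BayesianBandit
end GraphBandit

theorem mainTheorem6 {K : ℕ} {Ω : Type*} [MeasurableSpace Ω] (μ : Measure Ω)
    [IsProbabilityMeasure μ] (M : GraphBandit.BayesianBandit K μ)
    (G : ℕ → Digraph (Fin K)) (A : ℕ → Ω → Fin K) (hA : M.IsTSN G A) (T : ℕ) :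
    M.bayesRegret A T ≤
      √((1 / 2 : ℝ) * ∑ t ∈ Finset.range T,
        (GraphBandit.mas (G t) : ℝ) * GraphBandit.shannonEntropy M.prior) := by
  rw [← Finset.sum_mul]
  exact GraphBandit.le_sqrt_of_forall_mul_le M.shannonEntropy_prior_nonneg
    (Finset.sum_nonneg fun t _ => Nat.cast_nonneg _) fun c hc => M.mul_bayesRegret_le hA T hc
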